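/- Let $d\ge 1$ and $\alpha\in(0,1)$. Let $\mathcal P_2(\mathbb R^d)$ be the set of Borel probability measures on $\mathbb R^d$ with finite second moment, let $\Pi(\mu,\nu)$ be the set of couplings of $\mu$ and $\nu$, and for $p>0$ and $\gamma\in\Pi(\mu,\nu)$ put $C_p(\gamma)=\left(\int|x-y|^p\,\gamma(dx,dy)\right)^{1/p}$. A function $U:\mathcal P_2(\mathbb R^d)\to\mathbb R$ is differentiable at $\mu$ with derivative $D_\mu U(\mu)=\phi\in L^2(\mu;\mathbb R^d)$ if there is a modulus $\omega$ (a $[0,\infty]$-valued function of $r\ge 0$ with $\omega(0)=0$ and $\omega(r)\to0$ as $r\to0$) such that for all $\nu\in\mathcal P_2(\mathbb R^d)$ and all $\gamma\in\Pi(\mu,\nu)$, $$\left|U(\nu)-U(\mu)-\int (y-x)\cdot\phi(x)\,\gamma(dx,dy)\right|\le C_2(\gamma)\,\omega(C_2(\gamma)).$$ A tangent element $\psi$ at $\mu$ is a measurable family $(\psi_x)_x$ of probability measures on $\mathbb R^d$ with $\int\!\int|z|^2\,\psi_x(dz)\,\mu(dx)<\infty$, identified with the measure $\mu(dx)\psi_x(dz)$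 on $\mathbb R^d\times\mathbb R^d$; a function $\phi\in L^2(\mu;\mathbb R^d)$ is identified with the tangent element $x\mapsto\delta_{\phi(x)}$. For tangent elements $\psi,\psi'$ at $\mu$, $d_\mu(\psi,\psi')^2$ is the infimum of $\mathbb E|Z-Z'|^2$ over triples $(X,Z,Z')$ such that $(X,Z)$ has law $\mu(dx)\psi_x(dz)$ and $(X,Z')$ has law $\mu(dx)\psi'_x(dz)$. A parallel transport of $\psi$ along $\gamma\in\Pi(\mu,\nu)$ is the law of a process $(X_t,Z_t)_{t\in[0,1]}$ with continuous paths in $\mathbb R^d\times\mathbb R^d$ such that almost surely $t\mapsto Z_t$ is $C^1$ with zero derivative, $(X_0,X_1)$ has law $\gamma$, and $(X_0,Z_0)$ has law $\mu(dx)\psi_x(dz)$; $\mathcal T^\gamma(\psi)$ denotes the resulting tangent element at $\nu$, given by the law of $(X_1,Z_1)$. If $\psi$ is given by a function, $\mathcal T^\gamma(\psi)$ depends only on $\psi$ and $\gamma$. Let $U:\mathcal P_2(\mathbb R^d)\to\mathbb R$ be differentiable at every $\mu\in\mathcal P_2(\mathbb R^d)$ and suppose that $$J_\alpha(D_\mu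 U):=\sup\left\{\frac{d_\nu\big(\mathcal T^\gamma(D_\mu U(\mu)),D_\mu U(\nu)\big)}{C_{2\alpha}(\gamma)^\alpha}\ :\ \mu,\nu\in\mathcal P_2(\mathbb R^d),\ \gamma\in\Pi(\mu,\nu),\ 0<C_2(\gamma)<1\right\}<\infty .$$ Then for every $\mu\in\mathcal P_2(\mathbb R^d)$ there is an $\alpha$-Hölder continuous function $\phi_\mu:\mathbb R^d\to\mathbb R^d$ with $D_\mu U(\mu)=\phi_\mu$ $\mu$-almost everywhere and $$\|\phi_\mu\|_{\mathcal C^\alpha}:=\sup_{x\neq y}\frac{|\phi_\mu(x)-\phi_\mu(y)|}{|x-y|^\alpha}\ \le\ J_\alpha(D_\mu U).$$ -/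

import Mathlib

open MeasureTheory Set Filter Topology
open scoped NNReal ENNReal

noncomputable section

namespace WassersteinTransport

/-- `ℝ^d` with its Euclidean norm. -/
abbrev Euc (d : ℕ) : Type := EuclideanSpace ℝ (Fin d)

/-- `𝒫₂(ℝ^d)`: Borel probability measures on `ℝ^d` with finite second moment. -/
def P2 (d : ℕ) : Type :=
  {μ : Measure (Euc d) // IsProbabilityMeasure μ ∧ ∫⁻ x, ‖x‖ₑ ^ (2 : ℝ) ∂μ < ∞}

/-- The measure underlying an element of `𝒫₂(ℝ^d)`. -/
def P2.toMeasure {d : ℕ} (μ : P2 d) : Measure (Euc d) := μ.1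

/-- `γ ∈ Π(μ, ν)`. (Such a `γ` is automatically a probability measure.) -/
structure IsCoupling {d : ℕ} (μ ν : P2 d) (γ : Measure (Euc d × Euc d)) : Prop where
  map_fst : γ.map Prod.fst = μ.toMeasure
  map_snd : γ.map Prod.snd = ν.toMeasure

/-- `C_p(γ) = (∫ |x - y|^p dγ)^{1/p}`, as an element of `[0, ∞]`. -/
def transportCost {d : ℕ} (p : ℝ) (γ : Measure (Euc d × Euc d)) : ℝ≥0∞ :=
  (∫⁻ q, ‖q.1 - q.2‖ₑ ^ p ∂γ) ^ (1 / p)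

/-- `φ` is (a representative in `L²(μ; ℝ^d)` of) the derivative `D_μ U(μ)`: for some modulus `ω`,
`|U(ν) - U(μ) - ∫ (y - x) · φ(x) dγ| ≤ C₂(γ) ω(C₂(γ))` for every `ν` and every `γ ∈ Π(μ, ν)`.
The modulus may take the value `∞` away from `0`, so nothing is required for large `C₂(γ)`. -/
def HasWDerivAt {d : ℕ} (U : P2 d → ℝ) (φ : Euc d → Euc d) (μ : P2 d) : Prop :=
  MemLp φ 2 μ.toMeasure ∧
    ∃ ω : ℝ≥0∞ → ℝ≥0∞, ω 0 = 0 ∧ Tendsto ω (𝓝 0) (𝓝 0) ∧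
      ∀ (ν : P2 d) (γ : Measure (Euc d × Euc d)), IsCoupling μ ν γ →
        ENNReal.ofReal |U ν - U μ - ∫ q, inner ℝ (q.2 - q.1) (φ q.1) ∂γ| ≤
          transportCost 2 γ * ω (transportCost 2 γ)

/-- The deterministic tangent element `x ↦ δ_{φ(x)}` at `μ`. A tangent element `ψ` at `μ` is
represented throughout by the measure `μ(dx) ψ_x(dz)` on `ℝ^d × ℝ^d`; here it is the law of
`(X, φ(X))` for `X` of law `μ`. -/
def detTangent {d : ℕ} (μ : P2 d) (φ : Euc d → Euc d) : Measure (Euc d × Euc d) :=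
  μ.toMeasure.map (fun x => (x, φ x))

/-- The distance `d_μ` between two tangent elements at the same measure (each given as
`μ(dx) ψ_x(dz)`): the square root of the infimum of `∫ |z - z'|² dΓ(x, z, z')` over all `Γ` whose
`(x, z)`- and `(x, z')`-marginals are the two elements. -/
def tangentDist {d : ℕ} (ψ ψ' : Measure (Euc d × Euc d)) : ℝ≥0∞ :=
  (⨅ (Γ : Measure (Euc d × Euc d × Euc d))
      (_ : Γ.map (fun w => (w.1, w.2.1)) = ψ ∧ Γ.map (fun w => (w.1, w.2.2)) = ψ'),
      ∫⁻ w, ‖w.2.1 - w.2.2‖ₑ ^ (2 : ℝ) ∂Γ) ^ (1 / 2 : ℝ)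

/-- The Borel σ-algebra of the path space `𝒞([0,1], X)` with the topology of uniform
convergence. -/
instance pathMeasurableSpace (X : Type*) [TopologicalSpace X] :
    MeasurableSpace C(unitInterval, X) := borel _

instance pathBorelSpace (X : Type*) [TopologicalSpace X] :
    BorelSpace C(unitInterval, X) := ⟨rfl⟩

/-- The first-component path of a path in `ℝ^d × ℝ^d`. -/
def pathFst {d : ℕ} (w : C(unitInterval, Euc d × Euc d)) : C(unitInterval, Euc d) :=
  ContinuousMap.fst.comp w

/-- The second-component path, extended from `[0,1]` to `ℝ` by its end values; it is only used
on `[0,1]`. -/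
def pathSnd {d : ℕ} (w : C(unitInterval, Euc d × Euc d)) : ℝ → Euc d :=
  fun t => (w (Set.projIcc 0 1 zero_le_one t)).2

/-- `Ψ` is a parallel transport of the tangent element `ψ` along the Lagrangian curve `η`: it is
concentrated on paths whose second component is `C¹`, that component has zero derivative
`Ψ`-almost surely, the first component has law `η`, and the law at time `0` is `ψ`. -/
structure IsParallelTransport {d : ℕ} (ψ : Measure (Euc d × Euc d))
    (η : Measure C(unitInterval, Euc d)) (Ψ : Measure C(unitInterval, Euc d × Euc d)) : Prop where
  contDiff : ∀ᵐ w ∂Ψ, ContDiffOn ℝ 1 (pathSnd w) (Icc 0 1)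
  map_fst : Ψ.map pathFst = η
  deriv_eq_zero : ∀ᵐ w ∂Ψ, ∀ t ∈ Icc (0 : ℝ) 1, derivWithin (pathSnd w) (Icc 0 1) t = 0
  initial : Ψ.map (fun w => w 0) = ψ

/-- `Ψ` is a parallel transport of `ψ` along the coupling `γ`: a parallel transport along some
Lagrangian curve whose joint law at times `0` and `1` is `γ`. -/
def IsParallelTransportAlong {d : ℕ} (ψ γ : Measure (Euc d × Euc d))
    (Ψ : Measure C(unitInterval, Euc d × Euc d)) : Prop :=
  ∃ η : Measure C(unitInterval, Euc d),
    η.map (fun θ => (θ 0, θ 1)) = γ ∧ IsParallelTransport ψ η Ψ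

/-- `J_α(D) = sup d_ν(𝒯^γ(D(μ)), D(ν)) / C_{2α}(γ)^α ∈ [0, ∞]`, over all `μ, ν` and all
`γ ∈ Π(μ, ν)` with `0 < C₂(γ) < 1`. The transported element `𝒯^γ(D(μ))` is the law at time `1` of a
parallel transport of `D(μ)` along `γ`; as `D(μ)` is deterministic, it depends only on `γ`. -/
def holderJ {d : ℕ} (α : ℝ) (D : P2 d → Euc d → Euc d) : ℝ≥0∞ :=
  ⨆ (μ : P2 d) (ν : P2 d) (γ : Measure (Euc d × Euc d)) (_ : IsCoupling μ ν γ)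
    (_ : 0 < transportCost 2 γ ∧ transportCost 2 γ < 1)
    (Ψ : Measure C(unitInterval, Euc d × Euc d))
    (_ : IsParallelTransportAlong (detTangent μ (D μ)) γ Ψ),
    tangentDist (Ψ.map (fun w => w 1)) (detTangent ν (D ν)) / transportCost (2 * α) γ ^ α

end WassersteinTransport

end

open WassersteinTransport

namespace WassersteinTransport

variable {d : ℕ}

/-! Straight-line transport turns finiteness of `holderJ` into `∫ |D μ x - D ν y|² dγ ≤ J² ∫ |x -
y|^{2α} dγ` for couplings of cost below one (`lintegral_sub_le_holderJ`). Keeping a fraction `1 - ε`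
of the mass fixed shrinks the cost, and both sides scale by `ε`; hence every self-coupling of `μ`
obeys the bound (`HolderAlongCouplings.self`). Moving mass only between pairs that violate the
pointwise bound shows that such pairs are null (`HolderAlongCouplings.ae_prod`), so `D μ` is Hölder
on a set of full measure.

To reach all of `ℝ^d` with the same constant, mix a vanishing amount of a Gaussian into `μ`. The
derivatives at the mixtures are Hölder on dense sets and converge to `D μ` almost everywhere
(`HolderAlongCouplings.exists_mix_tendsto`); a compactness limit gives `φ`
(`exists_holderWith_limit`). -/

instance P2.isProbabilityMeasure (μ : P2 d) : IsProbabilityMeasure μ.toMeasure := μ.2.1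

lemma P2.lintegral_lt_top (μ : P2 d) : ∫⁻ x, ‖x‖ₑ ^ (2 : ℝ) ∂μ.toMeasure < ∞ := μ.2.2

lemma P2.ext_toMeasure {μ ν : P2 d} (h : μ.toMeasure = ν.toMeasure) : μ = ν := Subtype.ext h

lemma IsCoupling.isProbabilityMeasure {μ ν : P2 d} {γ : Measure (Euc d × Euc d)}
    (h : IsCoupling μ ν γ) : IsProbabilityMeasure γ :=
  (Measure.isProbabilityMeasure_map_iff measurable_fst.aemeasurable).1
    (by rw [h.map_fst]; infer_instance)

/-! ### Deterministic tangent elements and their transport -/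

/-- A deterministic second tangent element leaves only one admissible coupling. -/
lemma le_tangentDist_of_deterministic (γ : Measure (Euc d × Euc d)) {f g : Euc d → Euc d}
    (hf : Measurable f) (hg : Measurable g) :
    (∫⁻ q, ‖f q.1 - g q.2‖ₑ ^ (2 : ℝ) ∂γ) ^ (1 / 2 : ℝ) ≤
      tangentDist (γ.map fun q => (q.2, f q.1)) ((γ.map Prod.snd).map fun y => (y, g y)) := by
  refine ENNReal.rpow_le_rpow (le_iInf₂ fun Γ hΓ => ?_) (by norm_num)
  obtain ⟨h₁, h₂⟩ := hΓ
  have hae : ∀ᵐ w ∂Γ, w.2.2 = g w.1 := by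
    have : ∀ᵐ p ∂(Γ.map fun w : Euc d × Euc d × Euc d => (w.1, w.2.2)), p.2 = g p.1 := by
      rw [h₂]
      refine (ae_map_iff (by fun_prop)
        (measurableSet_eq_fun measurable_snd (hg.comp measurable_fst))).2 ?_
      exact ae_of_all _ fun _ => rfl
    exact ae_of_ae_map (by fun_prop) this
  have hm : Measurable fun p : Euc d × Euc d => ‖p.2 - g p.1‖ₑ ^ (2 : ℝ) := by fun_prop
  calc ∫⁻ q, ‖f q.1 - g q.2‖ₑ ^ (2 : ℝ) ∂γ
      = ∫⁻ p, ‖p.2 - g p.1‖ₑ ^ (2 : ℝ) ∂(γ.map fun q => (q.2, f q.1)) := by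
        rw [lintegral_map hm (by fun_prop)]
    _ = ∫⁻ w, ‖w.2.1 - g w.1‖ₑ ^ (2 : ℝ) ∂Γ := by
        rw [← h₁, lintegral_map hm (by fun_prop)]
    _ ≤ ∫⁻ w, ‖w.2.1 - w.2.2‖ₑ ^ (2 : ℝ) ∂Γ := by
        refine (lintegral_congr_ae ?_).le
        filter_upwards [hae] with w hw
        rw [hw]

/-- The path `t ↦ ((1 - t) x + t y, z)`. -/
def segmentPath : C((Euc d × Euc d) × Euc d, C(unitInterval, Euc d × Euc d)) :=
  ContinuousMap.curry
    ⟨fun p => ((1 - (p.2 : ℝ)) • p.1.1.1 + (p.2 : ℝ) • p.1.1.2, p.1.2), by fun_prop⟩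

lemma segmentPath_apply (p : (Euc d × Euc d) × Euc d) (t : unitInterval) :
    segmentPath p t = ((1 - (t : ℝ)) • p.1.1 + (t : ℝ) • p.1.2, p.2) := rfl

/-- Transport along straight segments is a parallel transport of a deterministic element. -/
lemma exists_isParallelTransportAlong (γ : Measure (Euc d × Euc d)) {f : Euc d → Euc d}
    (hf : Measurable f) :
    ∃ Ψ, IsParallelTransportAlong ((γ.map Prod.fst).map fun x => (x, f x)) γ Ψ ∧
      Ψ.map (fun w => w 1) = γ.map fun q => (q.2, f q.1) := by
  have hP : Measurable fun q : Euc d × Euc d => segmentPath (q, f q.1) :=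
    segmentPath.continuous.measurable.comp (by fun_prop)
  have hev (t : unitInterval) : Measurable fun w : C(unitInterval, Euc d × Euc d) => w t :=
    (continuous_eval_const t).measurable
  have hev' (t : unitInterval) : Measurable fun w : C(unitInterval, Euc d) => w t :=
    (continuous_eval_const t).measurable
  have hfst : Measurable (pathFst (d := d)) :=
    (ContinuousMap.continuous_postcomp ContinuousMap.fst).measurable
  have hconst : ∀ᵐ w ∂(γ.map fun q => segmentPath (q, f q.1)), ∀ t, (w t).2 = (w 0).2 := by
    have hc : IsClosed {w : C(unitInterval, Euc d × Euc d) | ∀ t, (w t).2 = (w 0).2} := by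
      simp only [ofPred_forall]
      exact isClosed_iInter fun t => isClosed_eq (by fun_prop) (by fun_prop)
    rw [ae_map_iff hP.aemeasurable hc.measurableSet]
    exact ae_of_all _ fun _ _ => rfl
  have hsnd : ∀ᵐ w ∂(γ.map fun q => segmentPath (q, f q.1)), pathSnd w = fun _ => (w 0).2 :=
    hconst.mono fun w hw => funext fun t => hw _
  refine ⟨γ.map fun q => segmentPath (q, f q.1),
    ⟨(γ.map fun q => segmentPath (q, f q.1)).map pathFst, ?_, ?_, rfl, ?_, ?_⟩, ?_⟩
  · rw [Measure.map_map hfst hP, Measure.map_map ((hev' 0).prodMk (hev' 1)) (hfst.comp hP)]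
    convert Measure.map_id
    ext1 q
    simp [pathFst, segmentPath_apply]
  · filter_upwards [hsnd] with w hw
    rw [hw]
    exact contDiffOn_const
  · filter_upwards [hsnd] with w hw t _
    rw [hw]
    simp
  · rw [Measure.map_map (hev 0) hP, Measure.map_map (by fun_prop) measurable_fst]
    congr 1
    ext1 q
    simp [segmentPath_apply]
  · rw [Measure.map_map (hev 1) hP]
    congr 1
    ext1 q
    simp [segmentPath_apply]

/-! ### From `holderJ` to an integral inequality -/

lemma detTangent_congr (μ : P2 d) {f g : Euc d → Euc d} (h : f =ᵐ[μ.toMeasure] g) :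
    detTangent μ f = detTangent μ g :=
  Measure.map_congr (h.mono fun x hx => by simp only [hx])

lemma IsCoupling.lintegral_sub_lt_top {μ ν : P2 d} {γ : Measure (Euc d × Euc d)}
    (h : IsCoupling μ ν γ) : ∫⁻ q, ‖q.1 - q.2‖ₑ ^ (2 : ℝ) ∂γ < ∞ := by
  have h₁ : ∫⁻ q, ‖q.1‖ₑ ^ (2 : ℝ) ∂γ < ∞ := by
    rw [← lintegral_map (f := fun x : Euc d => ‖x‖ₑ ^ (2 : ℝ)) (by fun_prop) measurable_fst,
      h.map_fst]
    exact μ.lintegral_lt_top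
  have h₂ : ∫⁻ q, ‖q.2‖ₑ ^ (2 : ℝ) ∂γ < ∞ := by
    rw [← lintegral_map (f := fun x : Euc d => ‖x‖ₑ ^ (2 : ℝ)) (by fun_prop) measurable_snd,
      h.map_snd]
    exact ν.lintegral_lt_top
  calc ∫⁻ q, ‖q.1 - q.2‖ₑ ^ (2 : ℝ) ∂γ
      ≤ ∫⁻ q, 2 ^ ((2 : ℝ) - 1) * (‖q.1‖ₑ ^ (2 : ℝ) + ‖q.2‖ₑ ^ (2 : ℝ)) ∂γ :=
        lintegral_mono fun q => (ENNReal.rpow_le_rpow (enorm_sub_le) (by norm_num)).trans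
          (ENNReal.rpow_add_le_mul_rpow_add_rpow _ _ (by norm_num))
    _ < ∞ := by
        rw [lintegral_const_mul _ (by fun_prop), lintegral_add_left (by fun_prop)]
        exact ENNReal.mul_lt_top (by norm_num) (ENNReal.add_lt_top.2 ⟨h₁, h₂⟩)

lemma IsCoupling.lintegral_sub_rpow_lt_top {μ ν : P2 d} {γ : Measure (Euc d × Euc d)}
    (h : IsCoupling μ ν γ) {p : ℝ} (hp₀ : 0 ≤ p) (hp₂ : p ≤ 2) :
    ∫⁻ q, ‖q.1 - q.2‖ₑ ^ p ∂γ < ∞ := by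
  have := h.isProbabilityMeasure
  calc ∫⁻ q, ‖q.1 - q.2‖ₑ ^ p ∂γ ≤ ∫⁻ q, (1 + ‖q.1 - q.2‖ₑ ^ (2 : ℝ)) ∂γ := by
        refine lintegral_mono fun q => ?_
        rcases le_total ‖q.1 - q.2‖ₑ 1 with h1 | h1
        · exact (ENNReal.rpow_le_one h1 hp₀).trans le_self_add
        · exact (ENNReal.rpow_le_rpow_of_exponent_le h1 hp₂).trans le_add_self
    _ < ∞ := by
        rw [lintegral_add_left (by fun_prop)]
        simpa using h.lintegral_sub_lt_top

/-- The bound on `J_α`, written out for one coupling of cost less than one. -/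
lemma lintegral_sub_le_holderJ {α : ℝ} (hα₀ : 0 < α) (hα₁ : α ≤ 1) {D : P2 d → Euc d → Euc d}
    (hD : ∀ μ : P2 d, AEStronglyMeasurable (D μ) μ.toMeasure)
    {μ ν : P2 d} {γ : Measure (Euc d × Euc d)} (hγ : IsCoupling μ ν γ)
    (hcost : ∫⁻ q, ‖q.1 - q.2‖ₑ ^ (2 : ℝ) ∂γ < 1) :
    ∫⁻ q, ‖D μ q.1 - D ν q.2‖ₑ ^ (2 : ℝ) ∂γ ≤
      holderJ α D ^ (2 : ℝ) * ∫⁻ q, ‖q.1 - q.2‖ₑ ^ (2 * α) ∂γ := by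
  have hcost' : transportCost 2 γ < 1 := by
    unfold transportCost
    exact ENNReal.rpow_lt_one hcost (by norm_num)
  -- The supremum omits zero cost, but then `γ` sits on the diagonal and the left side vanishes.
  rcases eq_or_ne (transportCost 2 γ) 0 with h0 | h0
  · have hdiag : ∀ᵐ q ∂γ, q.1 = q.2 := by
      unfold transportCost at h0
      rw [ENNReal.rpow_eq_zero_iff_of_pos (by norm_num), lintegral_eq_zero_iff (by fun_prop)] at h0
      filter_upwards [h0] with q hq
      simpa [sub_eq_zero] using hq
    have hμν : μ = ν := P2.ext_toMeasure <| by
      rw [← hγ.map_fst, ← hγ.map_snd]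
      exact Measure.map_congr hdiag
    subst hμν
    refine le_of_eq_of_le ?_ zero_le
    rw [← lintegral_zero (μ := γ)]
    refine lintegral_congr_ae (hdiag.mono fun q hq => ?_)
    simp [hq]
  · have hf := (hD μ).stronglyMeasurable_mk.measurable
    have hg := (hD ν).stronglyMeasurable_mk.measurable
    have hfe := (hD μ).ae_eq_mk
    have hge := (hD ν).ae_eq_mk
    set f := (hD μ).mk (D μ)
    set g := (hD ν).mk (D ν)
    obtain ⟨Ψ, hΨ, hΨ1⟩ := exists_isParallelTransportAlong γ hf
    have hμ : (γ.map Prod.fst).map (fun x => (x, f x)) = detTangent μ (D μ) := by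
      rw [hγ.map_fst, detTangent_congr μ hfe]; rfl
    have hν : (γ.map Prod.snd).map (fun x => (x, g x)) = detTangent ν (D ν) := by
      rw [hγ.map_snd, detTangent_congr ν hge]; rfl
    rw [hμ] at hΨ
    have hle : tangentDist (Ψ.map (fun w => w 1)) (detTangent ν (D ν)) /
        transportCost (2 * α) γ ^ α ≤ holderJ α D := by
      unfold holderJ
      exact le_iSup_of_le μ <| le_iSup_of_le ν <| le_iSup_of_le γ <| le_iSup_of_le hγ <|
        le_iSup_of_le ⟨pos_iff_ne_zero.2 h0, hcost'⟩ <| le_iSup_of_le Ψ <|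
        le_iSup_of_le hΨ le_rfl
    have hT : transportCost (2 * α) γ ^ α =
        (∫⁻ q, ‖q.1 - q.2‖ₑ ^ (2 * α) ∂γ) ^ (1 / 2 : ℝ) := by
      unfold transportCost
      rw [← ENNReal.rpow_mul]
      congr 1
      field_simp
    -- Clearing the quotient in `[0, ∞]` needs a nonzero finite denominator; finiteness uses `2α ≤
    -- 2`.
    have hne : transportCost (2 * α) γ ^ α ≠ 0 := by
      rw [hT]
      intro h
      rw [ENNReal.rpow_eq_zero_iff_of_pos (by norm_num), lintegral_eq_zero_iff (by fun_prop)] at h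
      refine h0 ?_
      unfold transportCost
      rw [ENNReal.rpow_eq_zero_iff_of_pos (by norm_num), lintegral_eq_zero_iff (by fun_prop)]
      filter_upwards [h] with q hq
      have : ‖q.1 - q.2‖ₑ = 0 := by
        simpa [ENNReal.rpow_eq_zero_iff_of_pos (show 0 < 2 * α by linarith),
          -enorm_eq_zero] using hq
      simp [this]
    have hne' : transportCost (2 * α) γ ^ α ≠ ∞ := by
      rw [hT]
      exact (ENNReal.rpow_lt_top_of_nonneg (by norm_num)
        (hγ.lintegral_sub_rpow_lt_top (by linarith) (by linarith)).ne).ne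
    rw [ENNReal.div_le_iff hne hne'] at hle
    have hmain := le_tangentDist_of_deterministic γ hf hg
    rw [← hΨ1, hν] at hmain
    replace hmain := hmain.trans hle
    rw [hT] at hmain
    have hfg : ∫⁻ q, ‖D μ q.1 - D ν q.2‖ₑ ^ (2 : ℝ) ∂γ =
        ∫⁻ q, ‖f q.1 - g q.2‖ₑ ^ (2 : ℝ) ∂γ := by
      have h1 : ∀ᵐ q ∂γ, D μ q.1 = f q.1 :=
        ae_of_ae_map measurable_fst.aemeasurable (by rw [hγ.map_fst]; exact hfe)
      have h2 : ∀ᵐ q ∂γ, D ν q.2 = g q.2 :=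
        ae_of_ae_map measurable_snd.aemeasurable (by rw [hγ.map_snd]; exact hge)
      refine lintegral_congr_ae ?_
      filter_upwards [h1, h2] with q h1 h2
      rw [h1, h2]
    rw [hfg]
    have := ENNReal.rpow_le_rpow hmain (show (0 : ℝ) ≤ 2 by norm_num)
    rw [ENNReal.mul_rpow_of_nonneg _ _ (by norm_num), ← ENNReal.rpow_mul, ← ENNReal.rpow_mul] at this
    simpa using this

/-! ### Mixtures and removal of the cost restriction -/

/-- The measure `(1 - ε) μ + ε ν`. -/
noncomputable def P2.mix (ε : ℝ≥0∞) (hε : ε ≤ 1) (μ ν : P2 d) : P2 d :=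
  ⟨(1 - ε) • μ.toMeasure + ε • ν.toMeasure, by
    constructor
    · constructor
      simp [tsub_add_cancel_of_le hε]
    · rw [lintegral_add_measure, lintegral_smul_measure, lintegral_smul_measure]
      have hε' : ε < ∞ := hε.trans_lt ENNReal.one_lt_top
      exact ENNReal.add_lt_top.2
        ⟨ENNReal.mul_lt_top (tsub_le_self.trans_lt ENNReal.one_lt_top) μ.lintegral_lt_top,
          ENNReal.mul_lt_top hε' ν.lintegral_lt_top⟩⟩

lemma P2.toMeasure_mix {ε : ℝ≥0∞} (hε : ε ≤ 1) (μ ν : P2 d) :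
    (P2.mix ε hε μ ν).toMeasure = (1 - ε) • μ.toMeasure + ε • ν.toMeasure := rfl

lemma P2.mix_self {ε : ℝ≥0∞} (hε : ε ≤ 1) (μ : P2 d) : P2.mix ε hε μ μ = μ :=
  P2.ext_toMeasure <| by
    rw [P2.toMeasure_mix, ← add_smul, tsub_add_cancel_of_le hε, one_smul]

lemma IsCoupling.mix {μ ν : P2 d} {κ : Measure (Euc d × Euc d)} (hκ : IsCoupling μ ν κ)
    {ε : ℝ≥0∞} (hε : ε ≤ 1) :
    IsCoupling μ (P2.mix ε hε μ ν)
      ((1 - ε) • μ.toMeasure.map (fun x => (x, x)) + ε • κ) := by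
  constructor
  · rw [Measure.map_add _ _ measurable_fst, Measure.map_smul, Measure.map_smul, hκ.map_fst,
      Measure.map_map measurable_fst (by fun_prop)]
    change (1 - ε) • Measure.map id _ + _ = _
    rw [Measure.map_id, ← add_smul, tsub_add_cancel_of_le hε, one_smul]
  · rw [Measure.map_add _ _ measurable_snd, Measure.map_smul, Measure.map_smul, hκ.map_snd,
      Measure.map_map measurable_snd (by fun_prop)]
    change (1 - ε) • Measure.map id _ + _ = _
    rw [Measure.map_id, P2.toMeasure_mix]

/-- `D` is `α`-Hölder with constant `J` along couplings of small cost. -/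
def HolderAlongCouplings (α : ℝ) (J : ℝ≥0∞) (D : P2 d → Euc d → Euc d) : Prop :=
  ∀ ⦃μ ν : P2 d⦄ ⦃γ : Measure (Euc d × Euc d)⦄, IsCoupling μ ν γ →
    ∫⁻ q, ‖q.1 - q.2‖ₑ ^ (2 : ℝ) ∂γ < 1 →
    ∫⁻ q, ‖D μ q.1 - D ν q.2‖ₑ ^ (2 : ℝ) ∂γ ≤
      J ^ (2 : ℝ) * ∫⁻ q, ‖q.1 - q.2‖ₑ ^ (2 * α) ∂γ

lemma lintegral_diag {μ : Measure (Euc d)} {F : Euc d × Euc d → ℝ≥0∞} (hF : Measurable F)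
    (h0 : ∀ x, F (x, x) = 0) : ∫⁻ q, F q ∂(μ.map fun x => (x, x)) = 0 := by
  rw [lintegral_map hF (by fun_prop)]
  simp [h0]

/-- The diagonal part of the coupling costs nothing, so only the `ε`-part appears on the right. Each
term on the left is used on its own later. -/
lemma HolderAlongCouplings.mix {α : ℝ} (hα : 0 < α) {J : ℝ≥0∞} {D : P2 d → Euc d → Euc d}
    (h : HolderAlongCouplings α J D) {μ ν : P2 d} {κ : Measure (Euc d × Euc d)}
    (hκ : IsCoupling μ ν κ) {ε : ℝ≥0∞} (hε : ε ≤ 1)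
    (hcost : ε * ∫⁻ q, ‖q.1 - q.2‖ₑ ^ (2 : ℝ) ∂κ < 1) :
    (1 - ε) * ∫⁻ q, ‖D μ q.1 - D (P2.mix ε hε μ ν) q.2‖ₑ ^ (2 : ℝ)
        ∂(μ.toMeasure.map fun x => (x, x)) +
      ε * ∫⁻ q, ‖D μ q.1 - D (P2.mix ε hε μ ν) q.2‖ₑ ^ (2 : ℝ) ∂κ ≤
      J ^ (2 : ℝ) * (ε * ∫⁻ q, ‖q.1 - q.2‖ₑ ^ (2 * α) ∂κ) := by
  have hdiag (p : ℝ) (hp : 0 < p) :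
      ∫⁻ q, ‖q.1 - q.2‖ₑ ^ p ∂(μ.toMeasure.map fun x : Euc d => (x, x)) = 0 :=
    lintegral_diag (by fun_prop) fun x => by simp [hp]
  have := h (hκ.mix hε) (by
    rw [lintegral_add_measure, lintegral_smul_measure, lintegral_smul_measure,
      hdiag 2 (by norm_num)]
    simpa using hcost)
  rw [lintegral_add_measure, lintegral_smul_measure, lintegral_smul_measure,
    lintegral_add_measure, lintegral_smul_measure, lintegral_smul_measure,
    hdiag (2 * α) (by linarith)] at this
  simpa using this

lemma inv_two_add_le {C : ℝ≥0∞} : (2 + C)⁻¹ ≤ 2⁻¹ :=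
  ENNReal.inv_le_inv.2 le_self_add

lemma inv_two_add_mul_lt {C : ℝ≥0∞} (hC : C < ∞) : (2 + C)⁻¹ * C < 1 := by
  rw [mul_comm, ← div_eq_mul_inv]
  refine ENNReal.div_lt_of_lt_mul' ?_
  rw [mul_one, add_comm]
  exact ENNReal.lt_add_right hC.ne (by norm_num)

lemma HolderAlongCouplings.self {α : ℝ} (hα : 0 < α) {J : ℝ≥0∞} {D : P2 d → Euc d → Euc d}
    (h : HolderAlongCouplings α J D) {μ : P2 d} {κ : Measure (Euc d × Euc d)}
    (hκ : IsCoupling μ μ κ) :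
    ∫⁻ q, ‖D μ q.1 - D μ q.2‖ₑ ^ (2 : ℝ) ∂κ ≤
      J ^ (2 : ℝ) * ∫⁻ q, ‖q.1 - q.2‖ₑ ^ (2 * α) ∂κ := by
  -- Small enough that `ε` times the squared cost is below one.
  set ε := (2 + ∫⁻ q, ‖q.1 - q.2‖ₑ ^ (2 : ℝ) ∂κ)⁻¹ with hεdef
  have hε : ε ≤ 1 := inv_two_add_le.trans (by norm_num)
  have hε0 : ε ≠ 0 := ENNReal.inv_ne_zero.2
    (ENNReal.add_ne_top.2 ⟨by norm_num, hκ.lintegral_sub_lt_top.ne⟩)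
  have := h.mix hα hκ hε (inv_two_add_mul_lt hκ.lintegral_sub_lt_top)
  -- Mixing `μ` with itself changes the coupling but not the measure, so the same `D μ` stands on
  -- both sides and `ε` cancels.
  rw [P2.mix_self] at this
  rw [← ENNReal.mul_le_mul_iff_right hε0 (hε.trans_lt ENNReal.one_lt_top).ne]
  calc _ ≤ _ := le_add_self
    _ ≤ _ := this
    _ = _ := by ring

/-! ### Pointwise Hölder bound for a single measure -/

/-- Transporting mass only within a symmetric set `B`, by the product coupling. -/
lemma isCoupling_prod_restrict (μ : P2 d) {B : Set (Euc d × Euc d)} (hB : MeasurableSet B)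
    (hsymm : Prod.swap ⁻¹' B = B) :
    IsCoupling μ μ ((μ.toMeasure.prod μ.toMeasure).restrict B +
      ((μ.toMeasure.prod μ.toMeasure).restrict Bᶜ).map fun q => (q.1, q.1)) := by
  have hfst : ((μ.toMeasure.prod μ.toMeasure).restrict B).map Prod.fst +
      ((μ.toMeasure.prod μ.toMeasure).restrict Bᶜ).map Prod.fst = μ.toMeasure := by
    rw [← Measure.map_add _ _ measurable_fst, Measure.restrict_add_restrict_compl hB,
      Measure.map_fst_prod, measure_univ, one_smul]
  have hsnd : ((μ.toMeasure.prod μ.toMeasure).restrict B).map Prod.snd =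
      ((μ.toMeasure.prod μ.toMeasure).restrict B).map Prod.fst := by
    conv_lhs => rw [← Measure.prod_swap, Measure.restrict_map measurable_swap hB, hsymm,
      Measure.map_map measurable_snd measurable_swap]
    rfl
  constructor
  · rw [Measure.map_add _ _ measurable_fst, Measure.map_map measurable_fst (by fun_prop)]
    exact hfst
  · rw [Measure.map_add _ _ measurable_snd, Measure.map_map measurable_snd (by fun_prop), hsnd]
    exact hfst

lemma isCoupling_prod (μ ν : P2 d) : IsCoupling μ ν (μ.toMeasure.prod ν.toMeasure) :=
  ⟨by simp, by simp⟩

lemma HolderAlongCouplings.ae_prod {α : ℝ} (hα₀ : 0 < α) (hα₁ : α ≤ 1) {J : ℝ≥0∞} (hJ : J < ∞)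
    {D : P2 d → Euc d → Euc d} (hD : ∀ μ : P2 d, AEStronglyMeasurable (D μ) μ.toMeasure)
    (h : HolderAlongCouplings α J D) (μ : P2 d) :
    ∀ᵐ q ∂(μ.toMeasure.prod μ.toMeasure),
      ‖D μ q.1 - D μ q.2‖ₑ ≤ J * ‖q.1 - q.2‖ₑ ^ α := by
  have hf := (hD μ).stronglyMeasurable_mk.measurable
  have hfe := (hD μ).ae_eq_mk
  set f := (hD μ).mk (D μ)
  have hfe' {κ : Measure (Euc d × Euc d)} (hκ : IsCoupling μ μ κ) :
      ∀ᵐ q ∂κ, D μ q.1 = f q.1 ∧ D μ q.2 = f q.2 :=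
    (ae_of_ae_map measurable_fst.aemeasurable (by rw [hκ.map_fst]; exact hfe)).and
      (ae_of_ae_map measurable_snd.aemeasurable (by rw [hκ.map_snd]; exact hfe))
  set F : Euc d × Euc d → ℝ≥0∞ := fun q => J ^ (2 : ℝ) * ‖q.1 - q.2‖ₑ ^ (2 * α) with hFdef
  set G : Euc d × Euc d → ℝ≥0∞ := fun q => ‖f q.1 - f q.2‖ₑ ^ (2 : ℝ) with hGdef
  have hFm : Measurable F := by fun_prop
  have hGm : Measurable G := by fun_prop
  -- The violating pairs; `B` is symmetric, so the product coupling can be used on it alone.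
  set B : Set (Euc d × Euc d) := {q | F q < G q}
  have hB : MeasurableSet B := measurableSet_lt hFm hGm
  have hsymm : Prod.swap ⁻¹' B = B := by
    ext q
    simp [B, F, G, enorm_sub_rev]
  set P := μ.toMeasure.prod μ.toMeasure
  have hκ := isCoupling_prod_restrict μ hB hsymm
  have hFfin : ∫⁻ q in B, F q ∂P ≠ ∞ := by
    refine ((setLIntegral_le_lintegral B F).trans_lt ?_).ne
    rw [lintegral_const_mul _ (by fun_prop)]
    exact ENNReal.mul_lt_top (ENNReal.rpow_lt_top_of_nonneg (by norm_num) hJ.ne)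
      ((isCoupling_prod μ μ).lintegral_sub_rpow_lt_top (by linarith) (by linarith))
  have hle : ∫⁻ q in B, G q ∂P ≤ ∫⁻ q in B, F q ∂P := by
    have h1 := h.self hα₀ hκ
    rw [← lintegral_const_mul _ (by fun_prop)] at h1
    have h2 : ∫⁻ q, ‖D μ q.1 - D μ q.2‖ₑ ^ (2 : ℝ) ∂(P.restrict B +
        (P.restrict Bᶜ).map fun q => (q.1, q.1)) = ∫⁻ q, G q ∂(P.restrict B +
        (P.restrict Bᶜ).map fun q => (q.1, q.1)) :=
      lintegral_congr_ae ((hfe' hκ).mono fun q hq => by simp only [hq, G])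
    rw [h2, lintegral_add_measure, lintegral_add_measure] at h1
    have h3 : ∫⁻ q, F q ∂((P.restrict Bᶜ).map fun q => (q.1, q.1)) = 0 := by
      rw [lintegral_map hFm (by fun_prop)]
      simp [F, hα₀]
    change _ ≤ _ + ∫⁻ q, F q ∂((P.restrict Bᶜ).map fun q => (q.1, q.1)) at h1
    rw [h3, add_zero] at h1
    exact le_self_add.trans h1
  -- `F < G` on `B`, yet `∫ G ≤ ∫ F < ∞` there: this forces `F = G` a.e. on `B`, so `B` is null.
  have hFG : F ≤ᵐ[P.restrict B] G := (ae_restrict_mem hB).mono fun q hq => le_of_lt hq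
  have hEq := ae_eq_of_ae_le_of_lintegral_le hFG hFfin hGm.aemeasurable hle
  have hnull : ∀ᵐ q ∂P, q ∉ B := by
    have : ∀ᵐ q ∂P.restrict B, False := by
      filter_upwards [hEq, ae_restrict_mem hB] with q h1 h2
      exact absurd h1 (ne_of_lt h2)
    have h0 : P.restrict B = 0 := by simpa using this
    exact measure_eq_zero_iff_ae_notMem.1 (Measure.restrict_eq_zero.1 h0)
  filter_upwards [hnull, hfe' (isCoupling_prod μ μ)] with q hq hq'
  rw [hq'.1, hq'.2, ← ENNReal.rpow_le_rpow_iff (show (0 : ℝ) < 2 by norm_num),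
    ENNReal.mul_rpow_of_nonneg _ _ (by norm_num), ← ENNReal.rpow_mul, mul_comm α 2]
  exact not_lt.1 hq

/-- An almost everywhere Hölder bound on pairs is a Hölder bound on a set of full measure. -/
lemma exists_ae_mem_holder {μ : Measure (Euc d)} [IsProbabilityMeasure μ] {α : ℝ} (hα : 0 < α)
    {J : ℝ≥0∞} (hJ : J < ∞) {f : Euc d → Euc d}
    (h : ∀ᵐ q ∂(μ.prod μ), ‖f q.1 - f q.2‖ₑ ≤ J * ‖q.1 - q.2‖ₑ ^ α) :
    ∃ S : Set (Euc d), (∀ᵐ x ∂μ, x ∈ S) ∧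
      ∀ x ∈ S, ∀ y ∈ S, edist (f x) (f y) ≤ J * edist x y ^ α := by
  refine ⟨{x | x ∈ μ.support ∧ ∀ᵐ y ∂μ, ‖f x - f y‖ₑ ≤ J * ‖x - y‖ₑ ^ α}, ?_, ?_⟩
  · filter_upwards [Measure.support_mem_ae (μ := μ), Measure.ae_ae_of_ae_prod h] with x h1 h2
    exact ⟨h1, h2⟩
  · rintro x ⟨-, hx⟩ x' ⟨hs, hx'⟩
    -- As `x'` lies in the support, points `y` good for both `x` and `x'` accumulate at `x'`.
    -- Letting `y → x'` in the triangle inequality keeps the constant `J`.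
    have : (𝓝 x' ⊓ ae μ).NeBot := by
      rw [inf_neBot_iff]
      intro U hU V hV
      have hpos := (Measure.mem_support_iff_forall x').1 hs U hU
      refine nonempty_of_measure_ne_zero (μ := μ) ?_
      rw [measure_inter_conull' (measure_mono_null (sdiff_subset_compl U V) hV)]
      exact hpos.ne'
    have hlim : Tendsto (fun y => J * (edist x y ^ α + edist x' y ^ α)) (𝓝 x' ⊓ ae μ)
        (𝓝 (J * (edist x x' ^ α + edist x' x' ^ α))) := by
      refine Tendsto.mono_left ?_ inf_le_left
      refine ENNReal.Tendsto.const_mul ?_ (.inr hJ.ne)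
      refine Continuous.tendsto (f := fun y => edist x y ^ α + edist x' y ^ α) ?_ x'
      fun_prop
    rw [edist_self, ENNReal.zero_rpow_of_pos hα, add_zero] at hlim
    refine ge_of_tendsto hlim (Filter.Eventually.filter_mono inf_le_right ?_)
    filter_upwards [hx, hx'] with y h1 h2
    rw [← edist_eq_enorm_sub, ← edist_eq_enorm_sub] at h1 h2
    rw [mul_add]
    exact (edist_triangle_right _ _ (f y)).trans (add_le_add h1 h2)

/-! ### Approximation and the global Hölder limit -/

/-- A measure in `𝒫₂` charging every nonempty open set. -/
lemma P2.exists_isOpenPosMeasure (d : ℕ) : ∃ g : P2 d, g.toMeasure.IsOpenPosMeasure := by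
  have hpos : (ProbabilityTheory.stdGaussian (Euc d)).IsOpenPosMeasure := by
    have : (ProbabilityTheory.gaussianReal 0 1).IsOpenPosMeasure :=
      (ProbabilityTheory.gaussianReal_absolutelyContinuous' 0 one_ne_zero).isOpenPosMeasure
    rw [← ProbabilityTheory.map_pi_eq_stdGaussian]
    exact (PiLp.continuous_toLp 2 _).isOpenPosMeasure_map (WithLp.toLp_surjective 2)
  refine ⟨⟨ProbabilityTheory.stdGaussian (Euc d), inferInstance, ?_⟩, hpos⟩
  have := (ProbabilityTheory.IsGaussian.memLp_two_id
    (μ := ProbabilityTheory.stdGaussian (Euc d))).eLpNorm_lt_top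
  simpa using lintegral_rpow_enorm_lt_top_of_eLpNorm_lt_top (by norm_num) (by norm_num) this

/-- Hölder maps on dense sets, converging on a nonempty set, have a Hölder limit defined
everywhere. -/
lemma exists_holderWith_limit {α : ℝ≥0} (hα : 0 < α) {J : ℝ≥0} {S : ℕ → Set (Euc d)}
    (hS : ∀ n, Dense (S n)) {f : ℕ → Euc d → Euc d}
    (hf : ∀ n, ∀ x ∈ S n, ∀ y ∈ S n, edist (f n x) (f n y) ≤ J * edist x y ^ (α : ℝ))
    {T : Set (Euc d)} (hT : T.Nonempty) (hTS : ∀ n, T ⊆ S n) {ψ : Euc d → Euc d}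
    (hψ : ∀ x ∈ T, Tendsto (fun n => f n x) atTop (𝓝 (ψ x))) :
    ∃ φ : Euc d → Euc d, HolderWith J α φ ∧ ∀ x ∈ T, ψ x = φ x := by
  have hα' : (0 : ℝ) < α := hα
  have hs : ∀ (n : ℕ) (x : Euc d), ∃ s ∈ S n, edist x s < ((n : ℝ≥0∞) + 1)⁻¹ := fun n x => by
    obtain ⟨s, h1, h2⟩ := EMetric.mem_closure_iff.1 (hS n x) ((n : ℝ≥0∞) + 1)⁻¹
      (ENNReal.inv_pos.2 (by finiteness))
    exact ⟨s, h1, h2⟩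
  choose s hsS hsd using hs
  have hs0 (x : Euc d) : Tendsto (fun n => edist x (s n x)) atTop (𝓝 0) := by
    refine tendsto_of_tendsto_of_tendsto_of_le_of_le tendsto_const_nhds
      (ENNReal.tendsto_inv_nat_nhds_zero.comp (tendsto_add_atTop_nat 1))
      (fun _ => zero_le) fun n => ?_
    simpa using (hsd n x).le
  have hsx (x : Euc d) : Tendsto (fun n => s n x) atTop (𝓝 x) := by
    rw [tendsto_iff_edist_tendsto_0]
    simpa [edist_comm] using hs0 x
  have hlim (x y : Euc d) : Tendsto (fun n => (J : ℝ≥0∞) * edist (s n x) (s n y) ^ (α : ℝ)) atTop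
      (𝓝 (J * edist x y ^ (α : ℝ))) :=
    ENNReal.Tendsto.const_mul (((hsx x).edist (hsx y)).ennrpow_const _) (.inr (by simp))
  have hTlim (x) (hx : x ∈ T) : Tendsto (fun n => f n (s n x)) atTop (𝓝 (ψ x)) := by
    rw [tendsto_iff_edist_tendsto_0]
    have h1 : Tendsto (fun n => (J : ℝ≥0∞) * edist (s n x) x ^ (α : ℝ) + edist (f n x) (ψ x)) atTop
        (𝓝 (J * edist x x ^ (α : ℝ) + 0)) :=
      (ENNReal.Tendsto.const_mul (((hsx x).edist tendsto_const_nhds).ennrpow_const _)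
        (.inr (by simp))).add (tendsto_iff_edist_tendsto_0.1 (hψ x hx))
    rw [edist_self, ENNReal.zero_rpow_of_pos hα', mul_zero, add_zero] at h1
    refine tendsto_of_tendsto_of_tendsto_of_le_of_le tendsto_const_nhds h1
      (fun _ => zero_le) fun n => ?_
    exact (edist_triangle _ (f n x) _).trans
      (add_le_add_left (hf n _ (hsS n x) _ (hTS n hx)) _)
  obtain ⟨x₀, hx₀⟩ := hT
  -- One ultrafilter serves all `x` at once, so the Hölder inequality passes to the limit.
  -- Boundedness comes from comparison with `x₀`, where the sequence converges; the two `+ 1` in `R`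
  -- absorb the two limits.
  have hcpt (x : Euc d) : ∃ z, Tendsto (fun n => f n (s n x)) (hyperfilter ℕ) (𝓝 z) := by
    set R : ℝ≥0∞ := J * edist x x₀ ^ (α : ℝ) + 1 + 1 with hR
    have hRtop : R ≠ ∞ := by
      have : edist x x₀ ≠ ∞ := edist_ne_top _ _
      rw [hR]; finiteness
    have h1 : ∀ᶠ n in atTop, f n (s n x) ∈ Metric.closedBall (ψ x₀) R.toReal := by
      have h2 := (hlim x x₀).eventually_lt_const
        (show (J * edist x x₀ ^ (α : ℝ) : ℝ≥0∞) < J * edist x x₀ ^ (α : ℝ) + 1 from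
          ENNReal.lt_add_right (by
            have : edist x x₀ ≠ ∞ := edist_ne_top _ _
            finiteness) one_ne_zero)
      have h3 := (tendsto_iff_edist_tendsto_0.1 (hTlim x₀ hx₀)).eventually_lt_const
        (zero_lt_one (α := ℝ≥0∞))
      filter_upwards [h2, h3] with n h2 h3
      rw [Metric.mem_closedBall, dist_edist]
      refine ENNReal.toReal_mono hRtop ((edist_triangle _ (f n (s n x₀)) _).trans ?_)
      exact add_le_add ((hf n _ (hsS n x) _ (hsS n x₀)).trans h2.le) h3.le
    obtain ⟨z, -, hz⟩ := (isCompact_closedBall (ψ x₀) R.toReal).ultrafilter_le_nhds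
      ((hyperfilter ℕ).map fun n => f n (s n x))
      (le_principal_iff.2 (Nat.hyperfilter_le_atTop h1))
    exact ⟨z, hz⟩
  choose φ hφ using hcpt
  refine ⟨φ, fun x y => ?_, fun x hx =>
    tendsto_nhds_unique ((hTlim x hx).mono_left Nat.hyperfilter_le_atTop) (hφ x)⟩
  exact le_of_tendsto_of_tendsto ((hφ x).edist (hφ y))
    ((hlim x y).mono_left Nat.hyperfilter_le_atTop)
    (Eventually.of_forall fun n => hf n _ (hsS n x) _ (hsS n y))

/-- Mixing a vanishing amount of `g` into `μ` perturbs `D μ` by little, almost everywhere. -/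
lemma HolderAlongCouplings.exists_mix_tendsto {α : ℝ} (hα₀ : 0 < α) (hα₁ : α ≤ 1) {J : ℝ≥0∞}
    (hJ : J < ∞) {D : P2 d → Euc d → Euc d}
    (hD : ∀ μ : P2 d, AEStronglyMeasurable (D μ) μ.toMeasure)
    (h : HolderAlongCouplings α J D) (μ g : P2 d) :
    ∃ ν : ℕ → P2 d, (∀ n, μ.toMeasure ≪ (ν n).toMeasure) ∧ (∀ n, g.toMeasure ≪ (ν n).toMeasure) ∧
      ∀ᵐ x ∂μ.toMeasure, Tendsto (fun n => D (ν n) x) atTop (𝓝 (D μ x)) := by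
  have hκ := isCoupling_prod μ g
  set C := ∫⁻ q, ‖q.1 - q.2‖ₑ ^ (2 : ℝ) ∂(μ.toMeasure.prod g.toMeasure) with hC
  set K := ∫⁻ q, ‖q.1 - q.2‖ₑ ^ (2 * α) ∂(μ.toMeasure.prod g.toMeasure) with hK
  have hCfin : C < ∞ := hκ.lintegral_sub_lt_top
  have hKfin : K < ∞ := hκ.lintegral_sub_rpow_lt_top (by linarith) (by linarith)
  -- Geometric decay makes the squared `L²` errors summable, giving a.e. convergence without a
  -- subsequence.
  set ε : ℕ → ℝ≥0∞ := fun n => (2 + C)⁻¹ * 2⁻¹ ^ n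
  have hεle (n : ℕ) : ε n ≤ (2 + C)⁻¹ :=
    mul_le_of_le_one_right' (pow_le_one₀ zero_le (by norm_num))
  have hε2 (n : ℕ) : ε n ≤ 2⁻¹ := (hεle n).trans inv_two_add_le
  have hε1 (n : ℕ) : ε n ≤ 1 := (hε2 n).trans (by norm_num)
  have hε0 (n : ℕ) : ε n ≠ 0 :=
    mul_ne_zero (ENNReal.inv_ne_zero.2 (by finiteness)) (pow_ne_zero _ (by norm_num))
  have hsub (n : ℕ) : 2⁻¹ ≤ 1 - ε n := by
    rw [← ENNReal.one_sub_inv_two]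
    exact tsub_le_tsub_left (hε2 n) 1
  have hμν (n : ℕ) : μ.toMeasure ≪ (P2.mix (ε n) (hε1 n) μ g).toMeasure := by
    rw [P2.toMeasure_mix]
    exact (Measure.absolutelyContinuous_smul
      (lt_of_lt_of_le (by norm_num) (hsub n)).ne').add_right _
  refine ⟨fun n => P2.mix (ε n) (hε1 n) μ g, hμν, fun n => ?_, ?_⟩
  · rw [P2.toMeasure_mix, add_comm]
    exact (Measure.absolutelyContinuous_smul (hε0 n)).add_right _
  have hmeas (n : ℕ) : AEMeasurable
      (fun x => ‖D μ x - D (P2.mix (ε n) (hε1 n) μ g) x‖ₑ ^ (2 : ℝ)) μ.toMeasure :=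
    (((hD μ).sub ((hD _).mono_ac (hμν n))).enorm).pow_const _
  have hbound (n : ℕ) : ∫⁻ x, ‖D μ x - D (P2.mix (ε n) (hε1 n) μ g) x‖ₑ ^ (2 : ℝ) ∂μ.toMeasure ≤
      2 * (J ^ (2 : ℝ) * (ε n * K)) := by
    have h1 := h.mix hα₀ hκ (hε1 n) ((mul_le_mul_left (hεle n) _).trans_lt
      (inv_two_add_mul_lt hCfin))
    -- The diagonal map is a measurable embedding, so the change of variables needs no measurability
    -- of `D`.
    have h2 : ∫⁻ x, ‖D μ x - D (P2.mix (ε n) (hε1 n) μ g) x‖ₑ ^ (2 : ℝ) ∂μ.toMeasure ≤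
        ∫⁻ q, ‖D μ q.1 - D (P2.mix (ε n) (hε1 n) μ g) q.2‖ₑ ^ (2 : ℝ)
          ∂(μ.toMeasure.map fun x => (x, x)) :=
      ((Measurable.measurableEmbedding (by fun_prop) fun x y hxy => (Prod.ext_iff.1 hxy).1
        ).lintegral_map _).ge
    calc _ ≤ _ := h2
      _ = 2 * (2⁻¹ * ∫⁻ q, ‖D μ q.1 - D (P2.mix (ε n) (hε1 n) μ g) q.2‖ₑ ^ (2 : ℝ)
          ∂(μ.toMeasure.map fun x => (x, x))) := by
        rw [← mul_assoc, ENNReal.mul_inv_cancel (by norm_num) (by norm_num), one_mul]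
      _ ≤ _ := mul_le_mul_right ((mul_le_mul_left (hsub n) _).trans (le_self_add.trans h1)) _
  have hsum : ∑' n, ∫⁻ x, ‖D μ x - D (P2.mix (ε n) (hε1 n) μ g) x‖ₑ ^ (2 : ℝ) ∂μ.toMeasure ≠ ∞ := by
    refine ((ENNReal.tsum_le_tsum hbound).trans_lt ?_).ne
    rw [ENNReal.tsum_mul_left, ENNReal.tsum_mul_left, ENNReal.tsum_mul_right, ENNReal.tsum_mul_left,
      ENNReal.tsum_geometric, ENNReal.one_sub_inv_two, inv_inv]
    have hJ2 : J ^ (2 : ℝ) ≠ ∞ := (ENNReal.rpow_lt_top_of_nonneg (by norm_num) hJ.ne).ne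
    have hC' : (2 + C)⁻¹ ≠ ∞ := ENNReal.inv_ne_top.2 (by simp)
    finiteness
  rw [← lintegral_tsum hmeas] at hsum
  filter_upwards [ae_lt_top' (AEMeasurable.tsum hmeas) hsum] with x hx
  have h0 := (ENNReal.tendsto_atTop_zero_of_tsum_ne_top hx.ne).ennrpow_const (1 / 2)
  rw [tendsto_iff_edist_tendsto_0]
  rw [ENNReal.zero_rpow_of_pos (by norm_num)] at h0
  refine h0.congr fun n => ?_
  rw [← ENNReal.rpow_mul, edist_comm, edist_eq_enorm_sub]
  norm_num

end WassersteinTransport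

open WassersteinTransport
theorem mainTheorem9 {d : ℕ} (α : ℝ≥0) (hα₀ : 0 < α) (hα₁ : α < 1)
    (U : P2 d → ℝ) (D : P2 d → Euc d → Euc d)
    (hD : ∀ μ : P2 d, HasWDerivAt U (D μ) μ)
    (hJ : holderJ (α : ℝ) D < ∞) :
    ∀ μ : P2 d, ∃ φ : Euc d → Euc d,
      eHolderNorm α φ ≤ holderJ (α : ℝ) D ∧ D μ =ᵐ[μ.toMeasure] φ := by
  intro μ
  have hα₀' : (0 : ℝ) < α := hα₀
  have hα₁' : (α : ℝ) ≤ 1 := hα₁.le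
  have hDm : ∀ μ : P2 d, AEStronglyMeasurable (D μ) μ.toMeasure :=
    fun μ => (hD μ).1.aestronglyMeasurable
  have hH : HolderAlongCouplings α (holderJ α D) D :=
    fun _ _ _ => lintegral_sub_le_holderJ hα₀' hα₁' hDm
  obtain ⟨g, hg⟩ := P2.exists_isOpenPosMeasure d
  obtain ⟨ν, hμν, hgν, hlim⟩ := hH.exists_mix_tendsto hα₀' hα₁' hJ hDm μ g
  choose S hSae hS using fun n =>
    exists_ae_mem_holder hα₀' hJ (hH.ae_prod hα₀' hα₁' hJ hDm (ν n))
  have hSdense (n : ℕ) : Dense (S n) :=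
    Measure.dense_of_ae (μ := g.toMeasure) ((hgν n).ae_le (hSae n))
  have hTae : ∀ᵐ x ∂μ.toMeasure, (∀ n, x ∈ S n) ∧
      Tendsto (fun n => D (ν n) x) atTop (𝓝 (D μ x)) :=
    (ae_all_iff.2 fun n => (hμν n).ae_le (hSae n)).and hlim
  have hJc : ((holderJ (α : ℝ) D).toNNReal : ℝ≥0∞) = holderJ (α : ℝ) D :=
    ENNReal.coe_toNNReal hJ.ne
  obtain ⟨φ, hφ, hφe⟩ := exists_holderWith_limit hα₀ (J := (holderJ (α : ℝ) D).toNNReal) hSdense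
    (f := fun n => D (ν n)) (by rw [hJc]; exact hS) hTae.exists
    (fun n x hx => hx.1 n) (fun x hx => hx.2)
  exact ⟨φ, hφ.eHolderNorm_le.trans_eq hJc, hTae.mono hφe⟩
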